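/- Let $\alpha,\beta>0$ with $\alpha\beta<1$, and put $$q=\frac{1+\sqrt{\alpha\beta}}{1-\sqrt{\alpha\beta}}>1,\qquad m_\alpha=\sqrt{2\alpha\Big(\tfrac{1}{\sqrt{\alpha\beta}}-1\Big)},\qquad m_\beta=\sqrt{2\beta\Big(\tfrac{1}{\sqrt{\alpha\beta}}-1\Big)},\qquad [n]_q=\frac{1-q^n}{1-q}.$$ Let $\mathcal F$ be a complex Hilbert space with orthonormal basis $\{|n,q\rangle : n=0,1,2,\dots\}$ (the $q$-deformed Fock space). On the subspace $\mathcal F_0$ of finite linear combinations of the basis vectors, let $$\hat b\,|0,q\rangle=0,\qquad \hat b\,|n,q\rangle=\sqrt{[n]_q}\,|n-1,q\rangle\ (n\ge 1),\qquad \hat b^\dagger|n,q\rangle=\sqrt{[n+1]_q}\,|n+1,q\rangle\ (n\ge 0),$$ and define, with domain $\mathcal F_0$, the position and momentum operators $\hat x=(\hat b^\dagger+\hat b)/m_\alpha$ and $\hat p=i(\hat b^\dagger-\hat b)/m_\beta$. **Theorem.** (a) The matrices of $\hat x$ and $\hat p$ in the basis $|n,q\rangle$ are the Hermitian Jacobi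 matrices with zero diagonal whose entries are $$\langle n,q|\hat x|n-1,q\rangle=\langle n-1,q|\hat x|n,q\rangle=\frac{\sqrt{[n]_q}}{m_\alpha},\qquad \langle n,q|\hat p|n-1,q\rangle=\overline{\langle n-1,q|\hat p|n,q\rangle}=\frac{i\sqrt{[n]_q}}{m_\beta}\qquad(n\ge1),$$ all other entries being zero. (b) Each operator $T\in\{\hat x,\hat p\}$ is densely defined and symmetric, is not essentially self-adjoint, and has deficiency indices $(1,1)$: the spaces $N_{\pm i}=\ker(T^*\mp i)$ are one-dimensional. (c) Each $T\in\{\hat x,\hat p\}$ has a one-parameter family of self-adjoint extensions. Precisely, for all unit vectors $\varphi\in N_i$ and $\psi\in N_{-i}$, the map sending $\theta\in\mathbb C$ with $|\theta|=1$ to the restriction of $T^*$ to $\operatorname{dom}(\overline T)+\mathbb C(\varphi+\theta\psi)$ is a bijection from the unit circle onto the set of all self-adjoint extensions of $T$. -/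

import Mathlib

noncomputable section

namespace QFock

/-! ### Unbounded operators: deficiency subspaces and self-adjoint extensions -/

section Operators

variable {H : Type*} [NormedAddCommGroup H] [InnerProductSpace ℂ H] [CompleteSpace H]

/-- An operator is essentially self-adjoint when it is closable and its closure is self-adjoint. -/
def IsEssentiallySelfAdjoint (T : H →ₗ.[ℂ] H) : Prop :=
  T.IsClosable ∧ IsSelfAdjoint T.closure

/-- The deficiency subspace `N_z = ker (T† - z)`, as a subspace of `H`. -/
def deficiencySubspace (T : H →ₗ.[ℂ] H) (z : ℂ) : Submodule ℂ H :=
  (LinearMap.ker (T.adjoint.toFun - z • T.adjoint.domain.subtype)).map T.adjoint.domain.subtype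

/-- The deficiency indices `(dim N_i, dim N_{-i})`. -/
def deficiencyIndices (T : H →ₗ.[ℂ] H) : ℕ∞ × ℕ∞ :=
  (Cardinal.toENat (Module.rank ℂ (deficiencySubspace T Complex.I)),
    Cardinal.toENat (Module.rank ℂ (deficiencySubspace T (-Complex.I))))

/-- The set of all self-adjoint extensions of `T`. -/
def selfAdjointExtensions (T : H →ₗ.[ℂ] H) : Set (H →ₗ.[ℂ] H) :=
  {S | T ≤ S ∧ IsSelfAdjoint S}

/-- The restriction of `T†` to `dom (closure T) + ℂ (φ + θ ψ)`, for a point `θ` of the unit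
circle. -/
def extensionFamily (T : H →ₗ.[ℂ] H) (φ ψ : H) (θ : Circle) : H →ₗ.[ℂ] H :=
  T.adjoint.domRestrict (T.closure.domain ⊔ Submodule.span ℂ {φ + (θ : ℂ) • ψ})

end Operators

/-! ### Parameters -/

/-- The `q`-number `[n]_q = (1 - q ^ n) / (1 - q)`. -/
def qNumber (q : ℝ) (n : ℕ) : ℝ := (1 - q ^ n) / (1 - q)

/-- `q = (1 + √(αβ)) / (1 - √(αβ))`. -/
def qParam (α β : ℝ) : ℝ := (1 + √(α * β)) / (1 - √(α * β))

/-- `m_α = √(2 α (1 / √(αβ) - 1))`. -/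
def mAlpha (α β : ℝ) : ℝ := √(2 * α * (1 / √(α * β) - 1))

/-- `m_β = √(2 β (1 / √(αβ) - 1))`. -/
def mBeta (α β : ℝ) : ℝ := √(2 * β * (1 / √(α * β) - 1))

/-- The Hermitian Jacobi matrix with zero diagonal, entries `a 1, a 2, …` below the diagonal and
their complex conjugates above it. -/
def jacobiMatrix (a : ℕ → ℂ) : Matrix ℕ ℕ ℂ := fun m n =>
  if m = n + 1 then a m else if n = m + 1 then starRingEnd ℂ (a n) else 0

/-! ### Operators on the Fock space

The Fock space is a Hilbert space `H` with orthonormal basis `e n = |n, q⟩`. -/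

section Fock

variable {H : Type*} [NormedAddCommGroup H] [InnerProductSpace ℂ H]

/-- The finite linear combinations of the states `|n, q⟩`. -/
def finiteStates (e : HilbertBasis ℕ ℂ H) : Submodule ℂ H :=
  Submodule.span ℂ (Set.range e)

/-- The states `|n, q⟩` as an algebraic basis of the space of finite linear combinations. -/
def stateBasis (e : HilbertBasis ℕ ℂ H) : Module.Basis ℕ ℂ (finiteStates e) :=
  Module.Basis.span e.orthonormal.linearIndependent

/-- `b |0⟩ = 0` and `b |n⟩ = √[n]_q |n - 1⟩` for `n ≥ 1`. -/
def annihilation (e : HilbertBasis ℕ ℂ H) (q : ℝ) : finiteStates e →ₗ[ℂ] H :=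
  (stateBasis e).constr ℂ fun n => match n with
    | 0 => 0
    | k + 1 => ((√(qNumber q (k + 1)) : ℝ) : ℂ) • e k

/-- `b† |n⟩ = √[n + 1]_q |n + 1⟩`. -/
def creation (e : HilbertBasis ℕ ℂ H) (q : ℝ) : finiteStates e →ₗ[ℂ] H :=
  (stateBasis e).constr ℂ fun n => ((√(qNumber q (n + 1)) : ℝ) : ℂ) • e (n + 1)

/-- The position operator `(b† + b) / m_α`, with domain the finite linear combinations of the
basis states. -/
def positionOp (e : HilbertBasis ℕ ℂ H) (α β : ℝ) : H →ₗ.[ℂ] H where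
  domain := finiteStates e
  toFun := (1 / (mAlpha α β : ℂ)) •
    (creation e (qParam α β) + annihilation e (qParam α β))

/-- The momentum operator `i (b† - b) / m_β`, with domain the finite linear combinations of the
basis states. -/
def momentumOp (e : HilbertBasis ℕ ℂ H) (α β : ℝ) : H →ₗ.[ℂ] H where
  domain := finiteStates e
  toFun := (Complex.I / (mBeta α β : ℂ)) •
    (creation e (qParam α β) - annihilation e (qParam α β))

end Fock

end QFock

end

/-!
The position and momentum operators are Jacobi operators: their matrices have zero diagonal and
off-diagonal entries `a n` of modulus `√[n]_q / m`. Since `[n + 1]_q = 1 + q [n]_q` and `q > 1`,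
these weights grow geometrically, `‖a n‖ ≤ r ‖a (n + 1)‖` with `r = q ^ (-1/2) < 1`.

*Deficiency indices.* A vector lies in `ker (T† - z)` iff its coordinates solve the three-term
recurrence `z c n = conj (a (n + 1)) c (n + 1) + a n c (n - 1)`, so it is determined by its zeroth
coordinate (`eq_mul_jacobiPoly_iff`). Solved for `c (n + 1)`, the recurrence has coefficient
`z / conj (a (n + 1)) → 0` at `c n` and a coefficient of modulus at most `r < 1` at `c (n - 1)`.
Hence every solution decays geometrically and is in `ℓ²` (`memℓp_jacobiPoly`), and
`ker (T† - z)` is a line for every `z`.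

*Self-adjoint extensions.* Operators are replaced by their graphs in `H × H`, with the symplectic
form `ω(x, y) = ⟪x₂, y₁⟫ - ⟪x₁, y₂⟫`: the graph of the adjoint is the `ω`-orthogonal complement of
the graph, and self-adjoint means Lagrangian. If `K` is the graph of the closure of `T`, the
orthogonal complement of `K` in `K.adjoint` is stable under the rotation `(p, r) ↦ (r, -p)`, whose
eigenvectors are the pairs `(u, ± i u)`; this is von Neumann's decomposition of the graph of `T†`
(`exists_add_of_mem_adjoint`). When both deficiency subspaces are lines, spanned by unit vectors `φ`
and `ψ`, the form `ω` becomes `-2i (conj a a' - conj b b')` in the coordinates `a φ + b ψ` modulo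
`K`. Its Lagrangian lines are those through `φ + θ ψ` with `|θ| = 1`, one for each `θ`
(`HasDeficiencyLines.adjoint_sup_span`, `HasDeficiencyLines.exists_eq_sup_span`,
`HasDeficiencyLines.sup_span_injective`). In particular `K` itself is not Lagrangian, so `T` is not
essentially self-adjoint.
-/

namespace QFock

/-! ### Lagrangian subspaces of `H × H` -/

section Symplectic

variable {H : Type*} [NormedAddCommGroup H] [InnerProductSpace ℂ H]

/-- The symplectic form `ω(x, y) = ⟪x₂, y₁⟫ - ⟪x₁, y₂⟫` on `H × H`, conjugate-linear in `x`. On the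
graph of the adjoint of a symmetric operator it is the boundary form
`⟪T† u, v⟫ - ⟪u, T† v⟫`. -/
noncomputable def symplecticForm : H × H →ₗ⋆[ℂ] H × H →ₗ[ℂ] ℂ :=
  LinearMap.mk₂'ₛₗ (starRingEnd ℂ) (RingHom.id ℂ)
    (fun x y => inner ℂ x.2 y.1 - inner ℂ x.1 y.2)
    (by intros; simp; ring)
    (by intros; simp; ring)
    (by intros; simp; ring)
    (by intros; simp; ring)

theorem symplecticForm_apply (x y : H × H) :
    symplecticForm x y = inner ℂ x.2 y.1 - inner ℂ x.1 y.2 := rfl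

theorem conj_symplecticForm (x y : H × H) :
    starRingEnd ℂ (symplecticForm x y) = -symplecticForm y x := by
  simp [symplecticForm_apply]

theorem symplecticForm_eq_zero_comm {x y : H × H} :
    symplecticForm x y = 0 ↔ symplecticForm y x = 0 := by
  rw [← neg_eq_zero (a := symplecticForm y x), ← conj_symplecticForm, starRingEnd_apply, star_eq_zero]

theorem mem_adjoint_iff_symplecticForm {G : Submodule ℂ (H × H)} {x : H × H} :
    x ∈ G.adjoint ↔ ∀ y ∈ G, symplecticForm y x = 0 := by
  rw [Submodule.mem_adjoint_iff]
  exact ⟨fun h y hy => h y.1 y.2 hy, fun h a b hab => h (a, b) hab⟩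

theorem adjoint_antitone {G K : Submodule ℂ (H × H)} (h : G ≤ K) : K.adjoint ≤ G.adjoint :=
  fun _ hx => mem_adjoint_iff_symplecticForm.2 fun y hy =>
    mem_adjoint_iff_symplecticForm.1 hx y (h hy)

theorem isClosed_adjoint (G : Submodule ℂ (H × H)) : IsClosed (G.adjoint : Set (H × H)) := by
  have : (G.adjoint : Set (H × H)) = ⋂ y ∈ G, {x | symplecticForm y x = 0} := by
    ext x
    simp only [SetLike.mem_coe, mem_adjoint_iff_symplecticForm, Set.mem_iInter, Set.mem_ofPred_eq]
  rw [this]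
  refine isClosed_biInter fun y _ => isClosed_eq ?_ continuous_const
  change Continuous fun x : H × H => inner ℂ y.2 x.1 - inner ℂ y.1 x.2
  fun_prop

theorem le_adjoint_comm {G K : Submodule ℂ (H × H)} : G ≤ K.adjoint ↔ K ≤ G.adjoint := by
  have key : ∀ {G K : Submodule ℂ (H × H)}, G ≤ K.adjoint → K ≤ G.adjoint := fun h x hx =>
    mem_adjoint_iff_symplecticForm.2 fun y hy =>
      symplecticForm_eq_zero_comm.1 (mem_adjoint_iff_symplecticForm.1 (h hy) x hx)
  exact ⟨key, key⟩

theorem adjoint_topologicalClosure (G : Submodule ℂ (H × H)) :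
    G.topologicalClosure.adjoint = G.adjoint := by
  refine le_antisymm (adjoint_antitone G.le_topologicalClosure) ?_
  rw [le_adjoint_comm]
  exact G.topologicalClosure_minimal (le_adjoint_comm.1 le_rfl) (isClosed_adjoint _)

/-- Von Neumann's decomposition: the part of `K.adjoint` orthogonal to the closed subspace `K` is
stable under `(p, r) ↦ (r, -p)`, whose eigenvectors are the pairs `(u, ± i u)`. -/
theorem exists_add_of_mem_adjoint [CompleteSpace H] {K : Submodule ℂ (H × H)}
    (hK : IsClosed (K : Set (H × H))) (hKs : K ≤ K.adjoint) {x : H × H} (hx : x ∈ K.adjoint) :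
    ∃ g ∈ K, ∃ u v : H, (u, Complex.I • u) ∈ K.adjoint ∧ (v, -Complex.I • v) ∈ K.adjoint ∧
      x = g + (u, Complex.I • u) + (v, -Complex.I • v) := by
  let L : Submodule ℂ (WithLp 2 (H × H)) :=
    K.comap (WithLp.linearEquiv 2 ℂ (H × H) : WithLp 2 (H × H) →ₗ[ℂ] H × H)
  have hL : IsClosed (L : Set (WithLp 2 (H × H))) := hK.preimage (WithLp.prod_continuous_ofLp _ _ _)
  have : CompleteSpace L := hL.completeSpace_coe
  obtain ⟨g, hg, d, hd, hgd⟩ := L.exists_add_mem_mem_orthogonal (WithLp.toLp 2 x)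
  obtain ⟨p, r⟩ := d
  have hgK : g.ofLp ∈ K := hg
  have hxg : x = g.ofLp + (p, r) := congrArg WithLp.ofLp hgd
  have hpr : (p, r) ∈ K.adjoint := by
    have : (p, r) = x - g.ofLp := by rw [hxg]; simp
    rw [this]
    exact sub_mem hx (hKs hgK)
  -- Orthogonality of `(p, r)` to `K` says that the rotated pair is `ω`-orthogonal to `K`.
  have hrp : (r, -p) ∈ K.adjoint := by
    rw [Submodule.mem_adjoint_iff]
    intro a b hab
    have := (Submodule.mem_orthogonal L _).1 hd (WithLp.toLp 2 (a, b)) hab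
    rw [WithLp.prod_inner_apply] at this
    simp at this
    simp [← this, add_comm]
  refine ⟨g.ofLp, hgK, (1 / 2 : ℂ) • (p - Complex.I • r), (1 / 2 : ℂ) • (p + Complex.I • r),
    ?_, ?_, ?_⟩
  · convert K.adjoint.smul_mem (1 / 2 : ℂ) (sub_mem hpr (K.adjoint.smul_mem Complex.I hrp)) using 1
    ext
    · simp
    · simp only [Prod.smul_mk, Prod.mk_sub_mk]
      rw [smul_comm, smul_sub, smul_smul, Complex.I_mul_I]
      module
  · convert K.adjoint.smul_mem (1 / 2 : ℂ) (add_mem hpr (K.adjoint.smul_mem Complex.I hrp)) using 1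
    ext
    · simp
    · simp only [Prod.smul_mk, Prod.mk_add_mk]
      rw [smul_comm, neg_smul, smul_add, smul_smul, Complex.I_mul_I]
      module
  · rw [hxg, add_assoc]
    congr 1
    ext
    · simp only [Prod.mk_add_mk]; module
    · simp only [Prod.mk_add_mk]
      rw [smul_comm Complex.I, smul_comm (-Complex.I), neg_smul, smul_sub, smul_add, smul_smul,
        Complex.I_mul_I]
      module

/-- The element `a (φ, i φ) + b (ψ, -i ψ)` of `H × H`: the point over `a φ + b ψ` on the graph of
any operator with `φ ↦ i φ` and `ψ ↦ -i ψ`. -/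
def boundaryVector (φ ψ : H) (a b : ℂ) : H × H :=
  a • (φ, Complex.I • φ) + b • (ψ, -Complex.I • ψ)

theorem smul_boundaryVector (φ ψ : H) (c a b : ℂ) :
    c • boundaryVector φ ψ a b = boundaryVector φ ψ (c * a) (c * b) := by
  simp only [boundaryVector, smul_add, smul_smul]

theorem symplecticForm_boundaryVector {φ ψ : H} (hφ : ‖φ‖ = 1) (hψ : ‖ψ‖ = 1) (a b a' b' : ℂ) :
    symplecticForm (boundaryVector φ ψ a b) (boundaryVector φ ψ a' b') =
      -2 * Complex.I * (starRingEnd ℂ a * a' - starRingEnd ℂ b * b') := by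
  have h1 : inner ℂ φ φ = 1 := by simp [inner_self_eq_norm_sq_to_K, hφ]
  have h2 : inner ℂ ψ ψ = 1 := by simp [inner_self_eq_norm_sq_to_K, hψ]
  simp only [boundaryVector, symplecticForm_apply, Prod.smul_mk, Prod.mk_add_mk, inner_add_left,
    inner_add_right, inner_smul_left, inner_smul_right, h1, h2, Complex.conj_I, map_neg]
  ring

theorem symplecticForm_boundaryVector_eq_zero {φ ψ : H} (hφ : ‖φ‖ = 1) (hψ : ‖ψ‖ = 1)
    {a b a' b' : ℂ} :
    symplecticForm (boundaryVector φ ψ a b) (boundaryVector φ ψ a' b') = 0 ↔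
      starRingEnd ℂ a * a' = starRingEnd ℂ b * b' := by
  rw [symplecticForm_boundaryVector hφ hψ, mul_eq_zero, sub_eq_zero]
  simp

theorem conj_mul_coe_circle (θ : Circle) : starRingEnd ℂ (θ : ℂ) * θ = 1 := by
  rw [Complex.conj_mul', Circle.norm_coe]; simp

/-- `K` is a closed `ω`-isotropic subspace of `H × H` whose deficiency subspaces, the spaces of `u`
with `(u, ± i u) ∈ K.adjoint`, are the lines spanned by the unit vectors `φ` and `ψ`. -/
structure HasDeficiencyLines (K : Submodule ℂ (H × H)) (φ ψ : H) : Prop where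
  isClosed : IsClosed (K : Set (H × H))
  le_adjoint : K ≤ K.adjoint
  norm_left : ‖φ‖ = 1
  norm_right : ‖ψ‖ = 1
  mem_left_iff : ∀ u : H, (u, Complex.I • u) ∈ K.adjoint ↔ u ∈ Submodule.span ℂ {φ}
  mem_right_iff : ∀ u : H, (u, -Complex.I • u) ∈ K.adjoint ↔ u ∈ Submodule.span ℂ {ψ}

namespace HasDeficiencyLines

variable {K : Submodule ℂ (H × H)} {φ ψ : H}

theorem boundaryVector_mem (h : HasDeficiencyLines K φ ψ) (a b : ℂ) :
    boundaryVector φ ψ a b ∈ K.adjoint :=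
  add_mem (Submodule.smul_mem _ _ ((h.mem_left_iff φ).2 (Submodule.mem_span_singleton_self φ)))
    (Submodule.smul_mem _ _ ((h.mem_right_iff ψ).2 (Submodule.mem_span_singleton_self ψ)))

/-- Von Neumann's decomposition in coordinates. -/
theorem exists_add_boundaryVector [CompleteSpace H] (h : HasDeficiencyLines K φ ψ) {x : H × H}
    (hx : x ∈ K.adjoint) : ∃ g ∈ K, ∃ a b : ℂ, x = g + boundaryVector φ ψ a b := by
  obtain ⟨g, hg, u, v, hu, hv, rfl⟩ := exists_add_of_mem_adjoint h.isClosed h.le_adjoint hx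
  obtain ⟨a, rfl⟩ := Submodule.mem_span_singleton.1 ((h.mem_left_iff u).1 hu)
  obtain ⟨b, rfl⟩ := Submodule.mem_span_singleton.1 ((h.mem_right_iff v).1 hv)
  refine ⟨g, hg, a, b, ?_⟩
  simp only [boundaryVector, Prod.smul_mk, add_assoc, smul_comm a, smul_comm b]

/-- On `K.adjoint` the symplectic form depends only on the coordinates modulo `K`. -/
theorem symplecticForm_add_boundaryVector (h : HasDeficiencyLines K φ ψ) {g g' : H × H}
    (hg : g ∈ K) (hg' : g' ∈ K) (a b a' b' : ℂ) :
    symplecticForm (g + boundaryVector φ ψ a b) (g' + boundaryVector φ ψ a' b') =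
      symplecticForm (boundaryVector φ ψ a b) (boundaryVector φ ψ a' b') := by
  have h1 : symplecticForm g (g' + boundaryVector φ ψ a' b') = 0 :=
    mem_adjoint_iff_symplecticForm.1
      (add_mem (h.le_adjoint hg') (h.boundaryVector_mem a' b')) g hg
  have h2 : symplecticForm (boundaryVector φ ψ a b) g' = 0 :=
    symplecticForm_eq_zero_comm.1
      (mem_adjoint_iff_symplecticForm.1 (h.boundaryVector_mem a b) g' hg')
  rw [map_add symplecticForm, LinearMap.add_apply, h1, map_add, h2, zero_add, zero_add]

theorem mem_sup_span_iff {w : H × H} {x : H × H} :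
    x ∈ K ⊔ Submodule.span ℂ {w} ↔ ∃ g ∈ K, ∃ c : ℂ, x = g + c • w := by
  simp only [Submodule.mem_sup, Submodule.mem_span_singleton]
  constructor
  · rintro ⟨g, hg, _, ⟨c, rfl⟩, rfl⟩
    exact ⟨g, hg, c, rfl⟩
  · rintro ⟨g, hg, c, rfl⟩
    exact ⟨g, hg, _, ⟨c, rfl⟩, rfl⟩

/-- The subspaces `K + ℂ ((φ, i φ) + θ (ψ, -i ψ))` are Lagrangian for the symplectic form. -/
theorem adjoint_sup_span [CompleteSpace H] (h : HasDeficiencyLines K φ ψ) (θ : Circle) :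
    (K ⊔ Submodule.span ℂ {boundaryVector φ ψ 1 θ}).adjoint =
      K ⊔ Submodule.span ℂ {boundaryVector φ ψ 1 θ} := by
  refine le_antisymm (fun x hx => ?_) (fun x hx => ?_)
  · obtain ⟨g, hg, a, b, rfl⟩ := h.exists_add_boundaryVector (adjoint_antitone le_sup_left hx)
    have h0 := mem_adjoint_iff_symplecticForm.1 hx (0 + boundaryVector φ ψ 1 θ)
      (by rw [zero_add]; exact Submodule.mem_sup_right (Submodule.mem_span_singleton_self _))
    rw [h.symplecticForm_add_boundaryVector K.zero_mem hg,
      symplecticForm_boundaryVector_eq_zero h.norm_left h.norm_right, map_one, one_mul] at h0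
    refine mem_sup_span_iff.2 ⟨g, hg, a, ?_⟩
    rw [smul_boundaryVector, mul_one, h0, mul_right_comm, conj_mul_coe_circle, one_mul]
  · refine mem_adjoint_iff_symplecticForm.2 fun y hy => ?_
    obtain ⟨g, hg, c, rfl⟩ := mem_sup_span_iff.1 hx
    obtain ⟨g', hg', c', rfl⟩ := mem_sup_span_iff.1 hy
    rw [smul_boundaryVector, smul_boundaryVector, h.symplecticForm_add_boundaryVector hg' hg,
      symplecticForm_boundaryVector_eq_zero h.norm_left h.norm_right, map_mul, map_mul, map_one]
    linear_combination (-(starRingEnd ℂ c' * c)) * conj_mul_coe_circle θ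

/-- `K` is not Lagrangian, since `(φ, i φ)` lies in `K.adjoint` but is not isotropic. -/
theorem adjoint_ne (h : HasDeficiencyLines K φ ψ) : K.adjoint ≠ K := fun hK => by
  have h1 := mem_adjoint_iff_symplecticForm.1 (h.boundaryVector_mem 1 0) _
    (hK ▸ h.boundaryVector_mem 1 0)
  simpa using (symplecticForm_boundaryVector_eq_zero h.norm_left h.norm_right).1 h1

/-- Every Lagrangian subspace containing `K` is one of the subspaces
`K + ℂ ((φ, i φ) + θ (ψ, -i ψ))`. -/
theorem exists_eq_sup_span [CompleteSpace H] (h : HasDeficiencyLines K φ ψ)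
    {S : Submodule ℂ (H × H)} (hKS : K ≤ S) (hS : S.adjoint = S) :
    ∃ θ : Circle, S = K ⊔ Submodule.span ℂ {boundaryVector φ ψ 1 θ} := by
  have hSK : S ≤ K.adjoint := hS ▸ adjoint_antitone hKS
  have hmem : ∀ g ∈ K, ∀ a b : ℂ, g + boundaryVector φ ψ a b ∈ S → boundaryVector φ ψ a b ∈ S :=
    fun g hg a b hab => by simpa using sub_mem hab (hKS hg)
  have hiso : ∀ a b a' b' : ℂ, boundaryVector φ ψ a b ∈ S → boundaryVector φ ψ a' b' ∈ S →
      starRingEnd ℂ a * a' = starRingEnd ℂ b * b' := fun a b a' b' h1 h2 =>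
    (symplecticForm_boundaryVector_eq_zero h.norm_left h.norm_right).1
      (mem_adjoint_iff_symplecticForm.1 (hS.symm ▸ h2) _ h1)
  -- If no boundary vector with `a ≠ 0` lay in `S`, then `S = K`, and `K` is not Lagrangian.
  obtain ⟨a, b, hab, ha⟩ : ∃ a b : ℂ, boundaryVector φ ψ a b ∈ S ∧ a ≠ 0 := by
    by_contra! hcon
    have hSleK : S ≤ K := fun x hx => by
      obtain ⟨g, hg, a, b, rfl⟩ := h.exists_add_boundaryVector (hSK hx)
      have hab := hmem g hg a b hx
      have ha := hcon a b hab
      have hb : b = 0 := by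
        have := hiso a b a b hab hab
        rw [ha, mul_zero, Complex.conj_mul'] at this
        simpa using this.symm
      simpa [ha, hb, boundaryVector] using hg
    exact h.adjoint_ne (le_antisymm hSleK hKS ▸ hS)
  have hθ : boundaryVector φ ψ 1 (a⁻¹ * b) ∈ S := by
    simpa [smul_boundaryVector, ha] using S.smul_mem a⁻¹ hab
  have hnorm : ‖a⁻¹ * b‖ = 1 := by
    have := hiso _ _ _ _ hθ hθ
    rw [map_one, one_mul, Complex.conj_mul'] at this
    have h2 : ‖a⁻¹ * b‖ ^ 2 = 1 := by exact_mod_cast this.symm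
    exact (pow_eq_one_iff_of_nonneg (norm_nonneg _) two_ne_zero).1 h2
  obtain ⟨θ, hθab⟩ : ∃ θ : Circle, (θ : ℂ) = a⁻¹ * b :=
    ⟨⟨a⁻¹ * b, mem_sphere_zero_iff_norm.2 hnorm⟩, rfl⟩
  rw [← hθab] at hθ
  refine ⟨θ, le_antisymm (fun x hx => ?_) ?_⟩
  · obtain ⟨g, hg, c, d, rfl⟩ := h.exists_add_boundaryVector (hSK hx)
    have h0 := hiso _ _ _ _ hθ (hmem g hg c d hx)
    rw [map_one, one_mul] at h0
    refine mem_sup_span_iff.2 ⟨g, hg, c, ?_⟩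
    rw [smul_boundaryVector, mul_one, h0, mul_right_comm, conj_mul_coe_circle, one_mul]
  · exact sup_le hKS ((Submodule.span_singleton_le_iff_mem _ _).2 hθ)

theorem sup_span_injective [CompleteSpace H] (h : HasDeficiencyLines K φ ψ) :
    Function.Injective fun θ : Circle => K ⊔ Submodule.span ℂ {boundaryVector φ ψ 1 θ} := by
  intro θ η hθη
  have hmem : ∀ ζ : Circle, boundaryVector φ ψ 1 ζ ∈
      K ⊔ Submodule.span ℂ {boundaryVector φ ψ 1 ζ} := fun ζ =>
    Submodule.mem_sup_right (Submodule.mem_span_singleton_self _)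
  have hη := hmem η
  rw [← show K ⊔ _ = K ⊔ _ from hθη, ← h.adjoint_sup_span] at hη
  have h0 := (symplecticForm_boundaryVector_eq_zero h.norm_left h.norm_right).1
    (mem_adjoint_iff_symplecticForm.1 hη _ (hmem θ))
  rw [map_one, one_mul] at h0
  ext
  linear_combination (θ : ℂ) * h0 + (η : ℂ) * conj_mul_coe_circle θ

end HasDeficiencyLines

end Symplectic

/-! ### Self-adjoint extensions of symmetric operators -/

section Extensions

variable {H : Type*} [NormedAddCommGroup H] [InnerProductSpace ℂ H] {T : H →ₗ.[ℂ] H}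

theorem closure_graph_le_of_le {S : H →ₗ.[ℂ] H} (hS : S.IsClosed) (hTS : T ≤ S) :
    T.closure.graph ≤ S.graph := by
  rw [← (hS.isClosable.leIsClosable hTS).graph_closure_eq_closure_graph]
  exact T.graph.topologicalClosure_minimal (LinearPMap.le_graph_of_le hTS) hS

theorem mem_iff_mem_span_of_finrank_eq_one {V : Submodule ℂ H} (hV : Module.finrank ℂ V = 1)
    {v : H} (hv : v ∈ V) (hv0 : v ≠ 0) (u : H) : u ∈ V ↔ u ∈ Submodule.span ℂ {v} := by
  refine ⟨fun hu => ?_, fun hu => (Submodule.span_singleton_le_iff_mem _ _).2 hv hu⟩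
  obtain ⟨c, hc⟩ := (finrank_eq_one_iff_of_nonzero' (⟨v, hv⟩ : V)
    (fun h => hv0 (congrArg Subtype.val h))).1 hV ⟨u, hu⟩
  exact Submodule.mem_span_singleton.2 ⟨c, congrArg Subtype.val hc⟩

theorem graph_domRestrict_map_fst {f : H →ₗ.[ℂ] H} {S : Submodule ℂ (H × H)} (hS : S ≤ f.graph) :
    (f.domRestrict (S.map (LinearMap.fst ℂ H H))).graph = S := by
  ext ⟨u, v⟩
  rw [LinearPMap.mem_graph_iff]
  constructor
  · rintro ⟨⟨w, hwS, hwf⟩, rfl, rfl⟩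
    obtain ⟨⟨w, w'⟩, hw, rfl⟩ := hwS
    have h1 : f.domRestrict (S.map (LinearMap.fst ℂ H H)) ⟨w, ⟨⟨(w, w'), hw, rfl⟩, hwf⟩⟩ =
        f ⟨w, hwf⟩ := LinearPMap.domRestrict_apply rfl
    have h2 : w' = f ⟨w, hwf⟩ := f.mem_graph_snd_inj (hS hw) (f.mem_graph ⟨w, hwf⟩) rfl
    rw [h2, ← h1] at hw
    exact hw
  · intro huv
    obtain ⟨⟨w, hw⟩, hwu, hwv⟩ := (LinearPMap.mem_graph_iff f).1 (hS huv)
    obtain rfl : w = u := hwu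
    exact ⟨⟨w, ⟨⟨(w, v), huv, rfl⟩, hw⟩⟩, rfl,
      (LinearPMap.domRestrict_apply (y := ⟨w, hw⟩) rfl).trans hwv⟩

variable [CompleteSpace H]

theorem mem_deficiencySubspace_iff {z : ℂ} {u : H} :
    u ∈ deficiencySubspace T z ↔ (u, z • u) ∈ T.adjoint.graph := by
  simp only [deficiencySubspace, Submodule.mem_map, LinearMap.mem_ker, LinearMap.sub_apply,
    LinearMap.smul_apply, Submodule.subtype_apply, LinearPMap.mem_graph_iff, sub_eq_zero]
  constructor
  · rintro ⟨v, hv, rfl⟩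
    exact ⟨v, rfl, hv⟩
  · rintro ⟨v, hv, hvu⟩
    exact ⟨v, by rw [hv]; exact hvu, hv⟩

theorem isClosable_of_isFormalAdjoint (hT : Dense (T.domain : Set H)) (hs : T.IsFormalAdjoint T) :
    T.IsClosable :=
  LinearPMap.isClosable_iff_exists_closed_extension.2
    ⟨T.adjoint, LinearPMap.adjoint_isClosed hT, hs.le_adjoint hT⟩

theorem graph_closure_adjoint (hT : Dense (T.domain : Set H)) (hs : T.IsFormalAdjoint T) :
    T.closure.graph.adjoint = T.adjoint.graph := by
  rw [← (isClosable_of_isFormalAdjoint hT hs).graph_closure_eq_closure_graph,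
    adjoint_topologicalClosure, LinearPMap.adjoint_graph_eq_graph_adjoint hT]

theorem isSelfAdjoint_iff_graph {S : H →ₗ.[ℂ] H} (hS : Dense (S.domain : Set H)) :
    IsSelfAdjoint S ↔ S.graph.adjoint = S.graph := by
  rw [LinearPMap.isSelfAdjoint_def, ← LinearPMap.adjoint_graph_eq_graph_adjoint hS]
  exact ⟨fun h => by rw [h], LinearPMap.eq_of_eq_graph⟩

theorem hasDeficiencyLines_closure (hT : Dense (T.domain : Set H)) (hs : T.IsFormalAdjoint T)
    (hp : Module.finrank ℂ (deficiencySubspace T Complex.I) = 1)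
    (hm : Module.finrank ℂ (deficiencySubspace T (-Complex.I)) = 1) {φ ψ : H}
    (hφ : φ ∈ deficiencySubspace T Complex.I) (hψ : ψ ∈ deficiencySubspace T (-Complex.I))
    (hφ1 : ‖φ‖ = 1) (hψ1 : ‖ψ‖ = 1) : HasDeficiencyLines T.closure.graph φ ψ where
  isClosed := (isClosable_of_isFormalAdjoint hT hs).closure_isClosed
  le_adjoint := by
    rw [graph_closure_adjoint hT hs]
    exact closure_graph_le_of_le (LinearPMap.adjoint_isClosed hT) (hs.le_adjoint hT)
  norm_left := hφ1
  norm_right := hψ1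
  mem_left_iff u := by
    rw [graph_closure_adjoint hT hs, ← mem_deficiencySubspace_iff]
    exact mem_iff_mem_span_of_finrank_eq_one hp hφ (norm_ne_zero_iff.1 (by simp [hφ1])) u
  mem_right_iff u := by
    rw [graph_closure_adjoint hT hs, ← mem_deficiencySubspace_iff]
    exact mem_iff_mem_span_of_finrank_eq_one hm hψ (norm_ne_zero_iff.1 (by simp [hψ1])) u

theorem deficiencyIndices_eq_one
    (hp : Module.finrank ℂ (deficiencySubspace T Complex.I) = 1)
    (hm : Module.finrank ℂ (deficiencySubspace T (-Complex.I)) = 1) :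
    deficiencyIndices T = (1, 1) := by
  simp [deficiencyIndices, Module.rank_eq_one_iff_finrank_eq_one.2 hp,
    Module.rank_eq_one_iff_finrank_eq_one.2 hm]

theorem graph_extensionFamily (hT : Dense (T.domain : Set H)) (hs : T.IsFormalAdjoint T)
    {φ ψ : H} (h : HasDeficiencyLines T.closure.graph φ ψ) (θ : Circle) :
    (extensionFamily T φ ψ θ).graph =
      T.closure.graph ⊔ Submodule.span ℂ {boundaryVector φ ψ 1 θ} := by
  have hle : T.closure.graph ⊔ Submodule.span ℂ {boundaryVector φ ψ 1 θ} ≤ T.adjoint.graph := by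
    rw [← graph_closure_adjoint hT hs]
    exact sup_le h.le_adjoint
      ((Submodule.span_singleton_le_iff_mem _ _).2 (h.boundaryVector_mem 1 θ))
  rw [← graph_domRestrict_map_fst hle, Submodule.map_sup, LinearPMap.graph_map_fst_eq_domain,
    Submodule.map_span, Set.image_singleton, extensionFamily]
  simp [boundaryVector]

theorem mem_selfAdjointExtensions_iff (hT : Dense (T.domain : Set H)) {S : H →ₗ.[ℂ] H} :
    S ∈ selfAdjointExtensions T ↔ T.graph ≤ S.graph ∧ S.graph.adjoint = S.graph := by
  rw [LinearPMap.le_graph_iff]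
  refine and_congr_right fun hTS => ?_
  exact isSelfAdjoint_iff_graph (hT.mono hTS.1)

/-- Von Neumann's parametrization of the self-adjoint extensions of a symmetric operator with
deficiency indices `(1, 1)`. -/
theorem bijOn_extensionFamily (hT : Dense (T.domain : Set H)) (hs : T.IsFormalAdjoint T)
    {φ ψ : H} (h : HasDeficiencyLines T.closure.graph φ ψ) :
    Set.BijOn (extensionFamily T φ ψ) Set.univ (selfAdjointExtensions T) := by
  refine ⟨fun θ _ => ?_, fun θ _ η _ hθη => ?_, fun S hS => ?_⟩
  · rw [mem_selfAdjointExtensions_iff hT, graph_extensionFamily hT hs h]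
    exact ⟨(LinearPMap.le_graph_of_le T.le_closure).trans le_sup_left, h.adjoint_sup_span θ⟩
  · apply h.sup_span_injective
    simp only [← graph_extensionFamily hT hs h, hθη]
  · obtain ⟨θ, hθ⟩ := h.exists_eq_sup_span (closure_graph_le_of_le hS.2.isClosed hS.1)
      ((mem_selfAdjointExtensions_iff hT).1 hS).2
    exact ⟨θ, trivial, LinearPMap.eq_of_eq_graph ((graph_extensionFamily hT hs h θ).trans hθ.symm)⟩

theorem not_isEssentiallySelfAdjoint (hT : Dense (T.domain : Set H))
    {φ ψ : H} (h : HasDeficiencyLines T.closure.graph φ ψ) : ¬ IsEssentiallySelfAdjoint T :=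
  fun hE => h.adjoint_ne ((isSelfAdjoint_iff_graph (hT.mono T.le_closure.1)).1 hE.2)

end Extensions

/-! ### Jacobi operators with geometrically growing weights -/

section Jacobi

/-- Solutions of a three-term recurrence whose leading coefficients tend to `0` and `r < 1` decay
geometrically: any `ρ` with `r < ρ ^ 2 < 1` is an admissible rate. -/
theorem exists_geometric_bound {u ε : ℕ → ℝ} {r : ℝ} (hr0 : 0 ≤ r) (hr1 : r < 1)
    (hu : ∀ n, 0 ≤ u n) (hε : Filter.Tendsto ε Filter.atTop (nhds 0))
    (h : ∀ n, u (n + 2) ≤ ε n * u (n + 1) + r * u n) :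
    ∃ C ρ : ℝ, 0 < ρ ∧ ρ < 1 ∧ ∃ N, ∀ n ≥ N, u n ≤ C * ρ ^ n := by
  obtain ⟨ρ, hρ0, hρ1, hρ⟩ : ∃ ρ : ℝ, 0 < ρ ∧ ρ < 1 ∧ ρ ^ 2 = (1 + r) / 2 := by
    refine ⟨√((1 + r) / 2), by positivity, ?_, Real.sq_sqrt (by positivity)⟩
    rw [Real.sqrt_lt' one_pos]
    linarith
  obtain ⟨N, hN⟩ := Filter.eventually_atTop.1
    (hε.eventually (ge_mem_nhds (show (0 : ℝ) < (1 - r) / 2 by linarith)))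
  refine ⟨max (u N / ρ ^ N) (u (N + 1) / ρ ^ (N + 1)), ρ, hρ0, hρ1, N, fun n hn => ?_⟩
  set C := max (u N / ρ ^ N) (u (N + 1) / ρ ^ (N + 1)) with hC
  have hC0 : 0 ≤ C := le_max_of_le_left (div_nonneg (hu N) (by positivity))
  obtain ⟨k, rfl⟩ := Nat.exists_eq_add_of_le hn
  clear hn
  induction k using Nat.twoStepInduction with
  | zero => exact (div_le_iff₀ (by positivity)).1 (le_max_left _ _)
  | one => exact (div_le_iff₀ (by positivity)).1 (le_max_right _ _)
  | more k h1 h2 =>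
    have hk := hN (N + k) (Nat.le_add_right _ _)
    have hρk : 0 ≤ C * ρ ^ (N + k) := by positivity
    calc u (N + (k + 2)) ≤ ε (N + k) * u (N + (k + 1)) + r * u (N + k) := h (N + k)
      _ ≤ (1 - r) / 2 * u (N + (k + 1)) + r * u (N + k) := by
        gcongr
        exact hu _
      _ ≤ (1 - r) / 2 * (C * ρ ^ (N + (k + 1))) + r * (C * ρ ^ (N + k)) := by
        have : 0 ≤ (1 - r) / 2 := by linarith
        gcongr
      _ = (C * ρ ^ (N + k)) * ((1 - r) / 2 * ρ + r) := by ring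
      _ ≤ (C * ρ ^ (N + k)) * ρ ^ 2 := by
        gcongr
        rw [hρ]
        nlinarith
      _ = C * ρ ^ (N + (k + 2)) := by ring

/-- The solution with initial value `1` of the recurrence
`z p n = conj (a (n + 1)) p (n + 1) + a n p (n - 1)`, where `a 0 = 0`: up to normalization, the
orthogonal polynomials of the Jacobi matrix of `a`, evaluated at `z`. -/
noncomputable def jacobiPoly (a : ℕ → ℂ) (z : ℂ) : ℕ → ℂ
  | 0 => 1
  | 1 => z / starRingEnd ℂ (a 1)
  | n + 2 => (z * jacobiPoly a z (n + 1) - a (n + 1) * jacobiPoly a z n) /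
      starRingEnd ℂ (a (n + 2))

variable {a : ℕ → ℂ}

theorem eq_mul_jacobiPoly_iff (h0 : a 0 = 0) (ha : ∀ n, a (n + 1) ≠ 0) {z : ℂ} {c : ℕ → ℂ} :
    (∀ n, z * c n = starRingEnd ℂ (a (n + 1)) * c (n + 1) + a n * c (n - 1)) ↔
      ∀ n, c n = c 0 * jacobiPoly a z n := by
  have hconj : ∀ n, starRingEnd ℂ (a (n + 1)) ≠ 0 := fun n => by simpa using ha n
  constructor
  · intro h n
    induction n using Nat.twoStepInduction with
    | zero => simp [jacobiPoly]
    | one =>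
      have h1 := h 0
      rw [h0, zero_mul, add_zero] at h1
      rw [jacobiPoly, ← mul_div_assoc, eq_div_iff (hconj 0), mul_comm (c 0), h1, mul_comm]
    | more n h1 h2 =>
      have h3 := h (n + 1)
      rw [Nat.add_sub_cancel] at h3
      rw [jacobiPoly, ← mul_div_assoc, eq_div_iff (hconj (n + 1))]
      linear_combination -h3 + z * h2 - a (n + 1) * h1
  · rintro h (_ | n)
    · rw [h (0 + 1), h0, zero_mul, add_zero, zero_add, jacobiPoly]
      field_simp [hconj 0]
    · rw [Nat.add_sub_cancel, h (n + 1 + 1), h (n + 1), h n, jacobiPoly]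
      field_simp [hconj (n + 1)]
      ring

/-- Geometric growth of the weights puts every solution of the eigenvalue recurrence in `ℓ²`: the
limit circle case. -/
theorem memℓp_jacobiPoly {r : ℝ} (hr0 : 0 < r) (hr1 : r < 1) (ha1 : a 1 ≠ 0)
    (hr : ∀ n, ‖a n‖ ≤ r * ‖a (n + 1)‖) (z : ℂ) : Memℓp (jacobiPoly a z) 2 := by
  -- Iterating the hypothesis, `‖a (n + 1)‖` grows at least like `r ^ (-n)`.
  have hlow : ∀ n, ‖a 1‖ ≤ r ^ n * ‖a (n + 1)‖ := by
    intro n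
    induction n with
    | zero => simp
    | succ n ih =>
      refine ih.trans ?_
      rw [pow_succ, mul_assoc]
      exact mul_le_mul_of_nonneg_left (hr (n + 1)) (by positivity)
  have ha1' : 0 < ‖a 1‖ := norm_pos_iff.2 ha1
  have hpos : ∀ n, 0 < ‖a (n + 1)‖ := fun n =>
    pos_of_mul_pos_right (ha1'.trans_le (hlow n)) (by positivity)
  have hε : Filter.Tendsto (fun n : ℕ => ‖z‖ / ‖a 1‖ * r ^ (n + 1)) Filter.atTop (nhds 0) := by
    simpa using ((tendsto_pow_atTop_nhds_zero_of_lt_one hr0.le hr1).comp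
      (Filter.tendsto_add_atTop_nat 1)).const_mul (‖z‖ / ‖a 1‖)
  obtain ⟨C, ρ, hρ0, hρ1, N, hN⟩ := exists_geometric_bound (u := fun n => ‖jacobiPoly a z n‖)
    hr0.le hr1 (fun _ => norm_nonneg _) hε fun n => by
      rw [jacobiPoly, norm_div, RCLike.norm_conj]
      have h1 : ‖z‖ / ‖a (n + 2)‖ ≤ ‖z‖ / ‖a 1‖ * r ^ (n + 1) := by
        rw [div_mul_eq_mul_div, div_le_div_iff₀ (hpos (n + 1)) ha1', mul_assoc]
        exact mul_le_mul_of_nonneg_left (hlow (n + 1)) (norm_nonneg z)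
      have h2 : ‖a (n + 1)‖ / ‖a (n + 2)‖ ≤ r := (div_le_iff₀ (hpos (n + 1))).2 (hr (n + 1))
      calc _ ≤ (‖z‖ * ‖jacobiPoly a z (n + 1)‖ + ‖a (n + 1)‖ * ‖jacobiPoly a z n‖) /
              ‖a (n + 2)‖ := by
            gcongr
            refine (norm_sub_le _ _).trans_eq ?_
            rw [norm_mul, norm_mul]
        _ = ‖z‖ / ‖a (n + 2)‖ * ‖jacobiPoly a z (n + 1)‖ +
              ‖a (n + 1)‖ / ‖a (n + 2)‖ * ‖jacobiPoly a z n‖ := by ring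
        _ ≤ _ := by gcongr
  refine memℓp_gen ?_
  have hsum : Summable fun n : ℕ => C ^ 2 * (ρ ^ 2) ^ n :=
    (summable_geometric_of_lt_one (by positivity) (by nlinarith)).mul_left _
  refine Summable.of_norm_bounded_eventually_nat hsum ?_
  filter_upwards [Filter.eventually_ge_atTop N] with n hn
  have := hN n hn
  simp only [ENNReal.toReal_ofNat, Real.rpow_ofNat, norm_pow, norm_norm]
  calc ‖jacobiPoly a z n‖ ^ 2 ≤ (C * ρ ^ n) ^ 2 := by gcongr
    _ = C ^ 2 * (ρ ^ 2) ^ n := by ring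

variable {H : Type*} [NormedAddCommGroup H] [InnerProductSpace ℂ H]

/-- The operator with domain the finite linear combinations of the states whose matrix is the
Jacobi matrix of `a`. It is used with `a 0 = 0`, so that the truncated index in `e (0 - 1)` does not
matter. -/
noncomputable def jacobiOp (e : HilbertBasis ℕ ℂ H) (a : ℕ → ℂ) : H →ₗ.[ℂ] H where
  domain := finiteStates e
  toFun := (stateBasis e).constr ℂ fun n =>
    a (n + 1) • e (n + 1) + starRingEnd ℂ (a n) • e (n - 1)

variable (e : HilbertBasis ℕ ℂ H)

theorem coe_stateBasis (n : ℕ) : (stateBasis e n : H) = e n :=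
  congrArg Subtype.val (Module.Basis.span_apply e.orthonormal.linearIndependent n)

theorem jacobiOp_stateBasis (n : ℕ) :
    jacobiOp e a (stateBasis e n) = a (n + 1) • e (n + 1) + starRingEnd ℂ (a n) • e (n - 1) :=
  (stateBasis e).constr_basis ℂ _ n

theorem inner_jacobiOp_stateBasis (h0 : a 0 = 0) (m n : ℕ) :
    inner ℂ (e m) (jacobiOp e a (stateBasis e n)) = jacobiMatrix a m n := by
  rw [jacobiOp_stateBasis, inner_add_right, inner_smul_right, inner_smul_right,
    orthonormal_iff_ite.1 e.orthonormal, orthonormal_iff_ite.1 e.orthonormal, jacobiMatrix]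
  rcases n with _ | n
  · by_cases h : m = 1 <;> simp [h0, h]
  · by_cases h : m = n + 1 + 1
    · simp [h, show n + 1 + 1 ≠ n by omega]
    · by_cases h' : m = n
      · simp [h', show n ≠ n + 1 + 1 by omega]
      · simp [h, h', Ne.symm h']

theorem conj_jacobiMatrix (a : ℕ → ℂ) (m n : ℕ) :
    starRingEnd ℂ (jacobiMatrix a m n) = jacobiMatrix a n m := by
  unfold jacobiMatrix
  by_cases h : m = n + 1
  · simp [h, show n ≠ n + 1 + 1 by omega]
  · by_cases h' : n = m + 1
    · simp [h', show m ≠ m + 1 + 1 by omega]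
    · simp [h, h']

theorem dense_finiteStates : Dense (finiteStates e : Set H) :=
  (finiteStates e).dense_iff_topologicalClosure_eq_top.2 e.dense_span

/-- The defining relation of the adjoint need only be checked on the states. -/
theorem inner_jacobiOp_eq_of_basis {y w : H}
    (h : ∀ n, inner ℂ y (jacobiOp e a (stateBasis e n)) = inner ℂ w (e n))
    (x : (jacobiOp e a).domain) : inner ℂ y (jacobiOp e a x) = inner ℂ w (x : H) := by
  have : (innerₛₗ ℂ y) ∘ₗ (jacobiOp e a).toFun = (innerₛₗ ℂ w) ∘ₗ (finiteStates e).subtype :=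
    (stateBasis e).ext fun n => (h n).trans (by simp [coe_stateBasis])
  exact LinearMap.congr_fun this x

theorem isFormalAdjoint_jacobiOp (h0 : a 0 = 0) :
    (jacobiOp e a).IsFormalAdjoint (jacobiOp e a) := by
  intro x y
  refine (inner_jacobiOp_eq_of_basis e (fun n => ?_) y).symm
  rw [← inner_conj_symm, ← inner_conj_symm _ (e n)]
  congr 1
  refine (inner_jacobiOp_eq_of_basis e (fun m => ?_) x).symm
  rw [inner_jacobiOp_stateBasis e h0, ← inner_conj_symm, inner_jacobiOp_stateBasis e h0,
    conj_jacobiMatrix]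

variable [CompleteSpace H]

/-- The eigenvalue equation for the adjoint, read off in coordinates. -/
theorem mem_deficiencySubspace_jacobiOp_iff {z : ℂ} {y : H} :
    y ∈ deficiencySubspace (jacobiOp e a) z ↔
      ∀ n, z * inner ℂ (e n) y = starRingEnd ℂ (a (n + 1)) * inner ℂ (e (n + 1)) y +
        a n * inner ℂ (e (n - 1)) y := by
  have hiff : ∀ n, inner ℂ y (jacobiOp e a (stateBasis e n)) = inner ℂ (z • y) (e n) ↔
      z * inner ℂ (e n) y = starRingEnd ℂ (a (n + 1)) * inner ℂ (e (n + 1)) y +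
        a n * inner ℂ (e (n - 1)) y := fun n => by
    rw [← (starRingEnd ℂ).injective.eq_iff, inner_conj_symm, inner_conj_symm, jacobiOp_stateBasis,
      inner_add_left, inner_smul_left, inner_smul_left, inner_smul_right, Complex.conj_conj, eq_comm]
  simp only [← hiff]
  rw [mem_deficiencySubspace_iff,
    LinearPMap.adjoint_graph_eq_graph_adjoint (T := jacobiOp e a) (dense_finiteStates e),
    Submodule.mem_adjoint_iff]
  constructor
  · intro h n
    have h1 := h _ _ ((jacobiOp e a).mem_graph (stateBasis e n))
    rw [sub_eq_zero] at h1
    rw [← inner_conj_symm, h1, inner_conj_symm, coe_stateBasis]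
  · intro h u v huv
    obtain ⟨x, rfl, rfl⟩ := (LinearPMap.mem_graph_iff _).1 huv
    rw [sub_eq_zero, ← inner_conj_symm, inner_jacobiOp_eq_of_basis e h x, inner_conj_symm]

theorem finrank_deficiencySubspace_jacobiOp {r : ℝ} (hr0 : 0 < r) (hr1 : r < 1) (h0 : a 0 = 0)
    (ha : ∀ n, a (n + 1) ≠ 0) (hr : ∀ n, ‖a n‖ ≤ r * ‖a (n + 1)‖) (z : ℂ) :
    Module.finrank ℂ (deficiencySubspace (jacobiOp e a) z) = 1 := by
  let p : lp (fun _ : ℕ => ℂ) 2 := ⟨jacobiPoly a z, memℓp_jacobiPoly hr0 hr1 (ha 0) hr z⟩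
  let y : H := e.repr.symm p
  have hy : ∀ n, inner ℂ (e n) y = jacobiPoly a z n := fun n => by
    rw [← e.repr_apply_apply, LinearIsometryEquiv.apply_symm_apply]
  have hy0 : y ≠ 0 := fun h => by
    have := hy 0
    rw [h, inner_zero_right, jacobiPoly] at this
    exact zero_ne_one this
  have hspan : deficiencySubspace (jacobiOp e a) z = Submodule.span ℂ {y} := by
    ext x
    rw [mem_deficiencySubspace_jacobiOp_iff, Submodule.mem_span_singleton,
      eq_mul_jacobiPoly_iff (c := fun n => inner ℂ (e n) x) h0 ha]
    constructor
    · intro h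
      refine ⟨inner ℂ (e 0) x, e.repr.injective (lp.ext (funext fun n => ?_))⟩
      rw [e.repr_apply_apply, e.repr_apply_apply, inner_smul_right, hy, ← h n]
    · rintro ⟨c, rfl⟩ n
      simp [hy, jacobiPoly]
  rw [hspan, finrank_span_singleton hy0]

end Jacobi

/-! ### The position and momentum operators -/

section Parameters

theorem one_lt_qParam {α β : ℝ} (hα : 0 < α) (hβ : 0 < β) (hαβ : α * β < 1) :
    1 < qParam α β := by
  have h0 : 0 < √(α * β) := Real.sqrt_pos.2 (mul_pos hα hβ)
  have h1 : √(α * β) < 1 := by rwa [Real.sqrt_lt' one_pos, one_pow]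
  rw [qParam, one_lt_div (by linarith)]
  linarith

theorem mAlpha_pos {α β : ℝ} (hα : 0 < α) (hβ : 0 < β) (hαβ : α * β < 1) : 0 < mAlpha α β := by
  have h0 : 0 < √(α * β) := Real.sqrt_pos.2 (mul_pos hα hβ)
  have h1 : √(α * β) < 1 := by rwa [Real.sqrt_lt' one_pos, one_pow]
  have h2 : 1 < 1 / √(α * β) := (one_lt_div h0).2 h1
  exact Real.sqrt_pos.2 (mul_pos (by positivity) (by linarith))

theorem mBeta_pos {α β : ℝ} (hα : 0 < α) (hβ : 0 < β) (hαβ : α * β < 1) : 0 < mBeta α β := by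
  simpa [mAlpha, mBeta, mul_comm β α] using mAlpha_pos hβ hα (by rwa [mul_comm])

theorem qNumber_zero (q : ℝ) : qNumber q 0 = 0 := by simp [qNumber]

theorem qNumber_succ {q : ℝ} (hq : 1 < q) (n : ℕ) : qNumber q (n + 1) = 1 + q * qNumber q n := by
  have : 1 - q ≠ 0 := by linarith
  unfold qNumber
  field_simp
  ring

theorem qNumber_nonneg {q : ℝ} (hq : 1 < q) (n : ℕ) : 0 ≤ qNumber q n := by
  induction n with
  | zero => rw [qNumber_zero]
  | succ n ih => rw [qNumber_succ hq]; positivity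

theorem sqrt_qNumber_le {q : ℝ} (hq : 1 < q) (n : ℕ) :
    √(qNumber q n) ≤ √q⁻¹ * √(qNumber q (n + 1)) := by
  rw [← Real.sqrt_mul (by positivity)]
  apply Real.sqrt_le_sqrt
  rw [qNumber_succ hq, ← div_eq_inv_mul, le_div_iff₀ (by linarith)]
  linarith

end Parameters

section Operators

variable {H : Type*} [NormedAddCommGroup H] [InnerProductSpace ℂ H] (e : HilbertBasis ℕ ℂ H)

/-- The matrix entries `c √[n]_q / m` below the diagonal: `c = 1` for the position operator and
`c = i` for the momentum operator. -/
noncomputable def fockWeight (c : ℂ) (q m : ℝ) (n : ℕ) : ℂ :=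
  c * ((√(qNumber q n) / m : ℝ) : ℂ)

theorem fockWeight_zero (c : ℂ) (q m : ℝ) : fockWeight c q m 0 = 0 := by
  simp [fockWeight, qNumber_zero]

/-- One formula covers both cases of the definition, because `[0]_q = 0`. -/
theorem annihilation_stateBasis (q : ℝ) (n : ℕ) :
    annihilation e q (stateBasis e n) = ((√(qNumber q n) : ℝ) : ℂ) • e (n - 1) := by
  rw [annihilation, Module.Basis.constr_basis]
  cases n <;> simp [qNumber_zero]

theorem creation_stateBasis (q : ℝ) (n : ℕ) :
    creation e q (stateBasis e n) = ((√(qNumber q (n + 1)) : ℝ) : ℂ) • e (n + 1) :=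
  (stateBasis e).constr_basis ℂ _ n

theorem positionOp_toFun (α β : ℝ) :
    (positionOp e α β).toFun = (jacobiOp e (fockWeight 1 (qParam α β) (mAlpha α β))).toFun := by
  unfold positionOp jacobiOp
  refine (stateBasis e).ext fun n => ?_
  rw [Module.Basis.constr_basis, LinearMap.smul_apply, LinearMap.add_apply,
    annihilation_stateBasis, creation_stateBasis]
  simp only [fockWeight, Complex.ofReal_div, map_mul, map_div₀, Complex.conj_ofReal, map_one]
  module

theorem positionOp_eq_jacobiOp (α β : ℝ) :
    positionOp e α β = jacobiOp e (fockWeight 1 (qParam α β) (mAlpha α β)) :=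
  congrArg (LinearPMap.mk (finiteStates e)) (positionOp_toFun e α β)

theorem momentumOp_toFun (α β : ℝ) :
    (momentumOp e α β).toFun = (jacobiOp e (fockWeight Complex.I (qParam α β) (mBeta α β))).toFun := by
  unfold momentumOp jacobiOp
  refine (stateBasis e).ext fun n => ?_
  rw [Module.Basis.constr_basis, LinearMap.smul_apply, LinearMap.sub_apply,
    annihilation_stateBasis, creation_stateBasis]
  simp only [fockWeight, Complex.ofReal_div, map_mul, map_div₀, Complex.conj_ofReal,
    Complex.conj_I]
  module

theorem momentumOp_eq_jacobiOp (α β : ℝ) :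
    momentumOp e α β = jacobiOp e (fockWeight Complex.I (qParam α β) (mBeta α β)) :=
  congrArg (LinearPMap.mk (finiteStates e)) (momentumOp_toFun e α β)

theorem finrank_deficiencySubspace_fockWeight [CompleteSpace H] {c : ℂ} {q m : ℝ} (hc : c ≠ 0)
    (hq : 1 < q) (hm : 0 < m) (z : ℂ) :
    Module.finrank ℂ (deficiencySubspace (jacobiOp e (fockWeight c q m)) z) = 1 := by
  have hr : √q⁻¹ < 1 := by
    rw [Real.sqrt_lt' one_pos, one_pow]
    exact inv_lt_one_of_one_lt₀ hq
  refine finrank_deficiencySubspace_jacobiOp e (r := √q⁻¹)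
    (Real.sqrt_pos.2 (inv_pos.2 (by linarith))) hr (fockWeight_zero c q m) (fun n => ?_)
    (fun n => ?_) z
  · have : 0 < √(qNumber q (n + 1)) := by
      rw [qNumber_succ hq]
      have := qNumber_nonneg hq n
      positivity
    exact mul_ne_zero hc (Complex.ofReal_ne_zero.2 (by positivity))
  · simp only [fockWeight, norm_mul, Complex.norm_real, norm_div, Real.norm_eq_abs,
      abs_of_nonneg (Real.sqrt_nonneg _), abs_of_pos hm]
    calc ‖c‖ * (√(qNumber q n) / m) ≤ ‖c‖ * ((√q⁻¹ * √(qNumber q (n + 1))) / m) := by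
          gcongr
          exact sqrt_qNumber_le hq n
      _ = √q⁻¹ * (‖c‖ * (√(qNumber q (n + 1)) / m)) := by ring

end Operators

end QFock

theorem theorem1 {H : Type*} [NormedAddCommGroup H] [InnerProductSpace ℂ H] [CompleteSpace H]
    (e : HilbertBasis ℕ ℂ H) (α β : ℝ) (hα : 0 < α) (hβ : 0 < β) (hαβ : α * β < 1) :
    -- the matrix elements of the two operators form Jacobi matrices
    (∀ m n : ℕ, inner ℂ (e m) (QFock.positionOp e α β (QFock.stateBasis e n)) =
      QFock.jacobiMatrix
        (fun k => ((√(QFock.qNumber (QFock.qParam α β) k) / QFock.mAlpha α β : ℝ) : ℂ)) m n) ∧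
    (∀ m n : ℕ, inner ℂ (e m) (QFock.momentumOp e α β (QFock.stateBasis e n)) =
      QFock.jacobiMatrix
        (fun k => Complex.I *
          ((√(QFock.qNumber (QFock.qParam α β) k) / QFock.mBeta α β : ℝ) : ℂ)) m n) ∧
    ∀ T ∈ ({QFock.positionOp e α β, QFock.momentumOp e α β} : Set (H →ₗ.[ℂ] H)),
      -- each operator is densely defined and symmetric
      Dense (T.domain : Set H) ∧ T.IsFormalAdjoint T ∧
      ¬ QFock.IsEssentiallySelfAdjoint T ∧
      QFock.deficiencyIndices T = (1, 1) ∧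
      -- its self-adjoint extensions form a family parametrized bijectively by the unit circle
      ∀ φ ∈ QFock.deficiencySubspace T Complex.I,
        ∀ ψ ∈ QFock.deficiencySubspace T (-Complex.I), ‖φ‖ = 1 → ‖ψ‖ = 1 →
          Set.BijOn (QFock.extensionFamily T φ ψ) Set.univ (QFock.selfAdjointExtensions T) := by
  have hq := QFock.one_lt_qParam hα hβ hαβ
  refine ⟨fun m n => ?_, fun m n => ?_, fun T hT => ?_⟩
  · refine ((congrArg (inner ℂ (e m)) (LinearMap.congr_fun (QFock.positionOp_toFun e α β)
      (QFock.stateBasis e n))).trans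
      (QFock.inner_jacobiOp_stateBasis e (QFock.fockWeight_zero _ _ _) m n)).trans ?_
    exact congrFun (congrFun (congrArg QFock.jacobiMatrix (funext fun k => one_mul _)) m) n
  · exact (congrArg (inner ℂ (e m)) (LinearMap.congr_fun (QFock.momentumOp_toFun e α β)
      (QFock.stateBasis e n))).trans
      (QFock.inner_jacobiOp_stateBasis e (QFock.fockWeight_zero _ _ _) m n)
  · obtain ⟨c, m, hc, hm, rfl⟩ : ∃ (c : ℂ) (m : ℝ), c ≠ 0 ∧ 0 < m ∧
        T = QFock.jacobiOp e (QFock.fockWeight c (QFock.qParam α β) m) := by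
      rcases hT with rfl | rfl
      · exact ⟨1, _, one_ne_zero, QFock.mAlpha_pos hα hβ hαβ, QFock.positionOp_eq_jacobiOp e α β⟩
      · exact ⟨Complex.I, _, Complex.I_ne_zero, QFock.mBeta_pos hα hβ hαβ,
          QFock.momentumOp_eq_jacobiOp e α β⟩
    have hd := QFock.dense_finiteStates e
    have hs := QFock.isFormalAdjoint_jacobiOp e (QFock.fockWeight_zero c (QFock.qParam α β) m)
    have hfin := QFock.finrank_deficiencySubspace_fockWeight e hc hq hm
    have hunit : ∀ z : ℂ, ∃ u ∈ QFock.deficiencySubspace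
        (QFock.jacobiOp e (QFock.fockWeight c (QFock.qParam α β) m)) z, ‖u‖ = 1 := fun z => by
      have := Module.nontrivial_of_finrank_pos (R := ℂ) (by rw [hfin z]; exact one_pos)
      obtain ⟨u, hu⟩ := exists_norm_eq (QFock.deficiencySubspace
        (QFock.jacobiOp e (QFock.fockWeight c (QFock.qParam α β) m)) z) zero_le_one
      exact ⟨u, u.2, hu⟩
    obtain ⟨φ, hφ, hφ1⟩ := hunit Complex.I
    obtain ⟨ψ, hψ, hψ1⟩ := hunit (-Complex.I)
    refine ⟨hd, hs, QFock.not_isEssentiallySelfAdjoint hd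
      (QFock.hasDeficiencyLines_closure hd hs (hfin _) (hfin _) hφ hψ hφ1 hψ1),
      QFock.deficiencyIndices_eq_one (hfin _) (hfin _), fun φ hφ ψ hψ hφ1 hψ1 => ?_⟩
    exact QFock.bijOn_extensionFamily hd hs
      (QFock.hasDeficiencyLines_closure hd hs (hfin _) (hfin _) hφ hψ hφ1 hψ1)
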